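/- Let $\mathfrak h$ be a separable complex Hilbert space and $B(\mathfrak h)$ the bounded operators on it. A quantum channel is a completely positive, unital, $w^*$-continuous linear map $\Phi:B(\mathfrak h)\to B(\mathfrak h)$, where the $w^*$-topology comes from the duality $x\mapsto \mathrm{tr}(x\,\cdot)$ with the trace class operators. Let $\mathcal P=(\mathcal P_t)_{t\in\mathfrak T}$ be a semigroup of quantum channels, that is, $\mathcal P_0=\mathrm{Id}$ and $\mathcal P_{s+t}=\mathcal P_s\mathcal P_t$ for all $s,t\in\mathfrak T$, where either $\mathfrak T=\mathbb N$ (so that $\mathcal P_n=\Phi^n$ for a single channel $\Phi$), with $m$ the counting measure, or $\mathfrak T=[0,+\infty)$ and $t\mapsto\mathcal P_t(x)$ is $w^*$-continuous for every $x\in B(\mathfrak h)$, with $m$ the Lebesgue measure. For a positive $x\in B(\mathfrak h)$ and $v\in\mathfrak h$ put \[ \mathfrak U(x)[v]=\int_{\mathfrak T}\mathrm{tr}\big(\mathcal P_{*t}(|v\rangle\langle v|)\,x\big)\,dm(t)\in[0,+\infty], \] where the predual map $\mathcal P_{*t}$ is given by $\mathrm{tr}(\mathcal P_{*t}(\rho)x)=\mathrm{tr}(\rho\,\mathcal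 P_t(x))$ for trace class $\rho$. Call $\mathfrak U(x)$ bounded if there is $C<\infty$ with $\mathfrak U(x)[v]\le C\|v\|^2$ for all $v$, and let $\mathrm{supp}\,\mathfrak U(x)=\{v:\mathfrak U(x)[v]=0\}^\perp$. The transient space $\mathcal T$ is the smallest closed subspace of $\mathfrak h$ containing $\mathrm{supp}\,\mathfrak U(x)$ for all $x\ge 0$ with $\mathfrak U(x)$ bounded; the recurrent space is $\mathcal R=\mathcal T^\perp$, and $\mathcal P$ is recurrent if $\mathcal R=\mathfrak h$ (equivalently $\mathcal T=\{0\}$). If $\mathcal P$ is recurrent, then the set of its fixed points \[ \mathcal F(\mathcal P)=\{x\in B(\mathfrak h):\mathcal P_t(x)=x\ \text{for all } t\in\mathfrak T\} \] is a $W^*$-algebra, i.e. a von Neumann algebra on $\mathfrak h$ (a unital $*$-subalgebra of $B(\mathfrak h)$ equal to its double commutant). -/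

import Mathlib

open MeasureTheory Topology
open scoped NNReal ENNReal InnerProductSpace CStarAlgebra

noncomputable section

/-- A bounded operator `T` on a Hilbert space is trace class (nuclear) if
`T = ∑ₙ |vₙ⟩⟨uₙ|` for some vectors with `∑ₙ ‖uₙ‖ ‖vₙ‖ < ∞`. -/
def IsTraceClass {H : Type*} [NormedAddCommGroup H] [InnerProductSpace ℂ H]
    (T : H →L[ℂ] H) : Prop :=
  ∃ u v : ℕ → H, Summable (fun n => ‖u n‖ * ‖v n‖) ∧
    ∀ w : H, HasSum (fun n => ⟪u n, w⟫_ℂ • v n) (T w)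

/-- The trace `∑ᵢ ⟨eᵢ, T eᵢ⟩` of a trace class operator `T`, computed in some orthonormal
(Hilbert) basis `(eᵢ)`; its value does not depend on the basis. -/
def opTrace {H : Type*} [NormedAddCommGroup H] [InnerProductSpace ℂ H] [CompleteSpace H]
    (T : H →L[ℂ] H) : ℂ :=
  ∑' e : (exists_hilbertBasis ℂ H).choose, ⟪(e : H), T (e : H)⟫_ℂ

/-- The w*-topology on `B(H)`, as the dual of the trace class operators: the coarsest topology
for which `x ↦ tr (x T)` is continuous for every trace class operator `T`. -/
abbrev weakStarTopology (H : Type*) [NormedAddCommGroup H] [InnerProductSpace ℂ H]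
    [CompleteSpace H] : TopologicalSpace (H →L[ℂ] H) :=
  ⨅ T : {T : H →L[ℂ] H // IsTraceClass T},
    TopologicalSpace.induced (fun x : H →L[ℂ] H => opTrace (x * T.1)) inferInstance

/-- A quantum channel on `B(H)` (Heisenberg picture): a completely positive, unital,
w*-continuous linear map. -/
structure QuantumChannel (H : Type*) [NormedAddCommGroup H] [InnerProductSpace ℂ H]
    [CompleteSpace H] where
  toMap : (H →L[ℂ] H) →CP (H →L[ℂ] H)
  map_one' : toMap 1 = 1
  weakStar_continuous' :
    Continuous[weakStarTopology H, weakStarTopology H] (fun x => toMap x)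

/-- A semigroup of quantum channels indexed by the times `𝔗`, with `t ↦ P t x` continuous into
the w*-topology for every `x`. For `𝔗 = ℕ` (discrete topology) the continuity is no condition and
these are exactly the families of powers of one quantum channel; for `𝔗 = ℝ≥0` these are the
quantum Markov semigroups. -/
structure QuantumChannelSemigroup (𝔗 : Type*) [AddMonoid 𝔗] [TopologicalSpace 𝔗]
    (H : Type*) [NormedAddCommGroup H] [InnerProductSpace ℂ H] [CompleteSpace H] where
  channel : 𝔗 → QuantumChannel H
  channel_zero : ∀ x, (channel 0).toMap x = x
  channel_add : ∀ s t x, (channel (s + t)).toMap x = (channel s).toMap ((channel t).toMap x)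
  weakStar_continuous : ∀ x, Continuous[inferInstance, weakStarTopology H]
    (fun t => (channel t).toMap x)

/-- Lebesgue measure on the half-line `[0, ∞)`. -/
def halfLineLebesgue : Measure ℝ≥0 :=
  Measure.map Real.toNNReal (volume.restrict (Set.Ici (0 : ℝ)))

namespace QuantumChannelSemigroup

variable {𝔗 : Type*} [AddMonoid 𝔗] [TopologicalSpace 𝔗] [MeasurableSpace 𝔗]
  {H : Type*} [NormedAddCommGroup H] [InnerProductSpace ℂ H] [CompleteSpace H]

/-- The fixed points (harmonic operators) of the semigroup. -/
def fixedPoints {𝔗 : Type*} [AddMonoid 𝔗] [TopologicalSpace 𝔗]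
    {H : Type*} [NormedAddCommGroup H] [InnerProductSpace ℂ H] [CompleteSpace H]
    (P : QuantumChannelSemigroup 𝔗 H) : Set (H →L[ℂ] H) :=
  {x | ∀ t, (P.channel t).toMap x = x}

/-- The form-potential `𝔘(x)[v] = ∫ tr (P₍*ₜ₎(|v⟩⟨v|) x) dm(t)`, with values in `[0, ∞]`, of a
positive operator `x`. The predual map `P₍*ₜ₎` is determined by the duality
`tr (P₍*ₜ₎(ρ) x) = tr (ρ Pₜ(x))`, which is used here with `ρ = |v⟩⟨v|`; for `x ≥ 0` this trace is
a nonnegative real number. -/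
def formPotential (P : QuantumChannelSemigroup 𝔗 H) (m : Measure 𝔗) (x : H →L[ℂ] H) (v : H) :
    ℝ≥0∞ :=
  ∫⁻ t, ENNReal.ofReal
    (opTrace (InnerProductSpace.rankOne ℂ v v * (P.channel t).toMap x)).re ∂m

/-- The form-potential `𝔘(x)` is a bounded quadratic form. -/
def IsBoundedPotential (P : QuantumChannelSemigroup 𝔗 H) (m : Measure 𝔗) (x : H →L[ℂ] H) :
    Prop :=
  ∃ C : ℝ≥0, ∀ v : H, P.formPotential m x v ≤ C * (‖v‖₊ : ℝ≥0∞) ^ 2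

/-- `supp 𝔘(x)`, the orthogonal complement of `ker 𝔘(x) = {v | 𝔘(x)[v] = 0}`. -/
def potentialSupport (P : QuantumChannelSemigroup 𝔗 H) (m : Measure 𝔗) (x : H →L[ℂ] H) :
    Submodule ℂ H :=
  (Submodule.span ℂ {v : H | P.formPotential m x v = 0})ᗮ

/-- The transient space: the smallest closed subspace that contains the supports of all bounded
form-potentials of positive operators. -/
def transientSpace (P : QuantumChannelSemigroup 𝔗 H) (m : Measure 𝔗) : Submodule ℂ H :=
  (⨆ x : {x : H →L[ℂ] H // 0 ≤ x ∧ P.IsBoundedPotential m x},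
    P.potentialSupport m x.1).topologicalClosure

/-- The recurrent space: the orthogonal complement of the transient space. -/
def recurrentSpace (P : QuantumChannelSemigroup 𝔗 H) (m : Measure 𝔗) : Submodule ℂ H :=
  (P.transientSpace m)ᗮ

/-- The semigroup is recurrent if the recurrent space is the whole space. -/
def IsRecurrent (P : QuantumChannelSemigroup 𝔗 H) (m : Measure 𝔗) : Prop :=
  P.recurrentSpace m = ⊤

end QuantumChannelSemigroup

end

/-! For a fixed point `x`, the Kadison–Schwarz inequality makes `y = star x * x` subharmonic: `y ≤
P_t y`. Recurrence turns this into equality. The increment `w = P_s y - y ≥ 0` has a telescoping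
potential, bounded by a multiple of `‖y‖ ‖v‖²`, and a vector where the potential vanishes is killed
by `w`. The support of a bounded potential is trivial, so `w = 0` (`IsRecurrent.eq_zero`).

Hence `star x * x` is fixed whenever `x` is, and polarization makes the fixed points a unital star
subalgebra. It is w*-closed because channels are w*-continuous, so von Neumann's double commutant
theorem applies; the latter is proved here for the w*-topology given by the trace pairing. -/

/-! ### Kadison–Schwarz inequality -/

section KadisonSchwarz

variable {A : Type*} [CStarAlgebra A] [PartialOrder A] [StarOrderedRing A]

theorem CStarMatrix.nonneg_apply_self {n : Type*} [Fintype n] {M : CStarMatrix n n A}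
    (hM : 0 ≤ M) (i : n) : 0 ≤ M i i := by
  refine AddSubmonoid.closure_induction (motive := fun M _ => 0 ≤ M i i) ?_ le_rfl
    (fun _ _ _ _ h h' => add_nonneg h h') (StarOrderedRing.nonneg_iff.mp hM)
  rintro _ ⟨N, rfl⟩
  simp only [CStarMatrix.mul_apply, CStarMatrix.star_apply]
  exact Finset.sum_nonneg fun j _ => star_mul_self_nonneg _

/-- The Kadison–Schwarz inequality for a unital completely positive map. -/
theorem CompletelyPositiveMap.star_mul_self_le {B : Type*} [CStarAlgebra B] [PartialOrder B]
    [StarOrderedRing B] (φ : A →CP B) (h1 : φ 1 = 1) (x : A) :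
    star (φ x) * φ x ≤ φ (star x * x) := by
  -- `star N * N` is `[[x*x, x*], [x, 1]]`; compressing its image under `φ` to the vector `(1, -φ
  -- x)` produces the Schur complement.
  let N : CStarMatrix (Fin 2) (Fin 2) A := CStarMatrix.ofMatrix !![x, 1; 0, 0]
  have hM : 0 ≤ (star N * N).map φ := φ.map_cstarMatrix_nonneg _ (star_mul_self_nonneg N)
  let W : CStarMatrix (Fin 2) (Fin 2) B := CStarMatrix.ofMatrix !![1, 0; -φ x, 0]
  have h := CStarMatrix.nonneg_apply_self (star_left_conjugate_nonneg hM W) 0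
  have e : (star W * (star N * N).map φ * W) 0 0 = φ (star x * x) - star (φ x) * φ x := by
    simp only [CStarMatrix.mul_apply, Fin.sum_univ_two, CStarMatrix.star_apply,
      CStarMatrix.map_apply]
    simp [W, N, h1, map_star φ, sub_eq_add_neg]
  rw [e] at h
  exact sub_nonneg.mp h

end KadisonSchwarz

/-! ### Trace of nuclear operators -/

section Trace

variable {H : Type*} [NormedAddCommGroup H] [InnerProductSpace ℂ H]

theorem HilbertBasis.summable_norm_inner_mul_inner {ι : Type*} (b : HilbertBasis ι ℂ H) (x y : H) :
    Summable fun i => ‖⟪x, b i⟫_ℂ‖ * ‖⟪b i, y⟫_ℂ‖ := by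
  simpa using (b.summable_inner_mul_inner x y).norm

theorem HilbertBasis.tsum_norm_inner_mul_inner_le {ι : Type*} (b : HilbertBasis ι ℂ H) (x y : H) :
    ∑' i, ‖⟪x, b i⟫_ℂ‖ * ‖⟪b i, y⟫_ℂ‖ ≤ ‖x‖ * ‖y‖ := by
  refine Real.tsum_le_of_sum_le (fun i => by positivity) fun s => ?_
  refine (Real.sum_mul_le_sqrt_mul_sqrt s _ _).trans ?_
  gcongr
  · rw [← Real.sqrt_sq (norm_nonneg x)]
    refine Real.sqrt_le_sqrt ?_
    simpa [norm_inner_symm x] using b.orthonormal.sum_inner_products_le (s := s) x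
  · rw [← Real.sqrt_sq (norm_nonneg y)]
    exact Real.sqrt_le_sqrt (b.orthonormal.sum_inner_products_le (s := s) y)

theorem exists_hilbertBasis_opTrace_eq [CompleteSpace H] (T : H →L[ℂ] H) :
    ∃ (w : Set H) (b : HilbertBasis w ℂ H), opTrace T = ∑' e, ⟪b e, T (b e)⟫_ℂ := by
  obtain ⟨b, hb⟩ := (exists_hilbertBasis ℂ H).choose_spec
  exact ⟨_, b, by rw [hb]; rfl⟩

/-- Parseval in each term, after exchanging the two sums; Cauchy–Schwarz and Bessel bound the double
sum by `∑ ‖u n‖ ‖v n‖`. -/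
theorem opTrace_eq_tsum [CompleteSpace H] {T : H →L[ℂ] H} {u v : ℕ → H} (hs : Summable fun n => ‖u n‖ * ‖v n‖)
    (hT : ∀ w : H, HasSum (fun n => ⟪u n, w⟫_ℂ • v n) (T w)) :
    opTrace T = ∑' n, ⟪u n, v n⟫_ℂ := by
  obtain ⟨w, b, hb⟩ := exists_hilbertBasis_opTrace_eq T
  have hF : Summable (Function.uncurry fun (n : ℕ) (e : w) => ⟪u n, b e⟫_ℂ * ⟪b e, v n⟫_ℂ) := by
    refine Summable.of_norm ((summable_prod_of_nonneg fun _ => norm_nonneg _).mpr ⟨fun n => ?_, ?_⟩)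
    · simpa [Function.uncurry] using b.summable_norm_inner_mul_inner (u n) (v n)
    · refine hs.of_nonneg_of_le (fun n => tsum_nonneg fun _ => norm_nonneg _) fun n => ?_
      simpa [Function.uncurry] using b.tsum_norm_inner_mul_inner_le (u n) (v n)
  rw [hb]
  calc ∑' e, ⟪b e, T (b e)⟫_ℂ = ∑' e, ∑' n, ⟪u n, b e⟫_ℂ * ⟪b e, v n⟫_ℂ := by
        refine tsum_congr fun e => ?_
        have := (hT (b e)).mapL (innerSL ℂ (b e))
        simpa [inner_smul_right] using this.tsum_eq.symm
    _ = ∑' n, ∑' e, ⟪u n, b e⟫_ℂ * ⟪b e, v n⟫_ℂ := hF.tsum_comm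
    _ = _ := tsum_congr fun n => b.tsum_inner_mul_inner _ _

theorem opTrace_mul_eq_tsum [CompleteSpace H] {T : H →L[ℂ] H} {u v : ℕ → H}
    (hs : Summable fun n => ‖u n‖ * ‖v n‖)
    (hT : ∀ w : H, HasSum (fun n => ⟪u n, w⟫_ℂ • v n) (T w)) (x : H →L[ℂ] H) :
    opTrace (x * T) = ∑' n, ⟪u n, x (v n)⟫_ℂ := by
  refine opTrace_eq_tsum (u := u) (v := fun n => x (v n)) ?_ fun w => ?_
  · refine (hs.mul_left ‖x‖).of_nonneg_of_le (fun _ => by positivity) fun n => ?_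
    calc ‖u n‖ * ‖x (v n)‖ ≤ ‖u n‖ * (‖x‖ * ‖v n‖) := by gcongr; exact x.le_opNorm _
      _ = _ := by ring
  · simpa using (hT w).mapL x

theorem hasSum_pi_single_rankOne (u v w : H) :
    HasSum (fun n : ℕ => ⟪(if n = 0 then u else 0 : H), w⟫_ℂ • v)
      (InnerProductSpace.rankOne ℂ v u w) := by
  convert hasSum_ite_eq (0 : ℕ) (⟪u, w⟫_ℂ • v) using 2 with n
  · split_ifs <;> simp
  · simp [InnerProductSpace.rankOne_apply]

omit [InnerProductSpace ℂ H] in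
theorem summable_pi_single_rankOne (u v : H) :
    Summable (fun n : ℕ => ‖(if n = 0 then u else 0 : H)‖ * ‖v‖) :=
  summable_of_ne_finset_zero (s := {0}) fun n hn => by
    rw [if_neg (by simpa using hn)]; simp

theorem isTraceClass_rankOne (u v : H) : IsTraceClass (InnerProductSpace.rankOne ℂ v u) :=
  ⟨_, fun _ => v, summable_pi_single_rankOne u v, hasSum_pi_single_rankOne u v⟩

theorem opTrace_mul_rankOne [CompleteSpace H] (x : H →L[ℂ] H) (u v : H) :
    opTrace (x * InnerProductSpace.rankOne ℂ v u) = ⟪u, x v⟫_ℂ := by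
  rw [opTrace_mul_eq_tsum (summable_pi_single_rankOne u v) (hasSum_pi_single_rankOne u v),
    tsum_eq_single 0]
  · simp
  · intro n hn; simp [hn]

theorem opTrace_rankOne_mul [CompleteSpace H] (x : H →L[ℂ] H) (u v : H) :
    opTrace (InnerProductSpace.rankOne ℂ v u * x) = ⟪u, x v⟫_ℂ := by
  have h : InnerProductSpace.rankOne ℂ v u * x =
      1 * InnerProductSpace.rankOne ℂ v (ContinuousLinearMap.adjoint x u) := by
    ext w; simp [ContinuousLinearMap.adjoint_inner_left]
  rw [h, opTrace_mul_rankOne]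
  simp [ContinuousLinearMap.adjoint_inner_left]

end Trace

/-! ### Double commutant theorem for the w*-topology -/

section DoubleCommutant

variable {H : Type*} [NormedAddCommGroup H] [InnerProductSpace ℂ H]

/-- The diagonal action of `x : H →L[ℂ] H` on the Hilbert sum `ℓ²(J, H)`. -/
noncomputable def lpAmplification (J : Type*) (x : H →L[ℂ] H) :
    lp (fun _ : J => H) 2 →L[ℂ] lp (fun _ : J => H) 2 :=
  have hle (f : lp (fun _ : J => H) 2) (j : J) : ‖x (f j)‖ ^ (2 : ℝ≥0∞).toReal ≤
      ‖x‖ ^ (2 : ℝ≥0∞).toReal * ‖f j‖ ^ (2 : ℝ≥0∞).toReal := by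
    rw [← Real.mul_rpow (norm_nonneg _) (norm_nonneg _)]
    exact Real.rpow_le_rpow (norm_nonneg _) (x.le_opNorm _) (by simp)
  LinearMap.mkContinuous
    { toFun := fun f => ⟨fun j => x (f j), memℓp_gen <|
        (((lp.memℓp f).summable (by simp)).mul_left _).of_nonneg_of_le
          (fun _ => by positivity) (hle f)⟩
      map_add' := fun f g => by ext j; exact map_add x (f j) (g j)
      map_smul' := fun c f => by ext j; exact map_smul x c (f j) }
    ‖x‖ fun f => lp.norm_le_of_forall_sum_le (by simp) (by positivity) fun s => by
      rw [Real.mul_rpow (norm_nonneg _) (norm_nonneg _)]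
      refine (Finset.sum_le_sum fun j _ => hle f j).trans ?_
      rw [← Finset.mul_sum]
      gcongr
      exact lp.sum_rpow_le_norm_rpow (by simp) f s

@[simp]
theorem lpAmplification_apply {J : Type*} (x : H →L[ℂ] H) (f : lp (fun _ : J => H) 2) (j : J) :
    lpAmplification J x f j = x (f j) := rfl

variable [CompleteSpace H]

theorem inner_lpAmplification_star {J : Type*} (x : H →L[ℂ] H) (f g : lp (fun _ : J => H) 2) :
    ⟪f, lpAmplification J x g⟫_ℂ = ⟪lpAmplification J (star x) f, g⟫_ℂ := by
  simp only [lp.inner_eq_tsum, lpAmplification_apply, ContinuousLinearMap.star_eq_adjoint,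
    ContinuousLinearMap.adjoint_inner_left]

/-- The density step of von Neumann's double commutant theorem, in an arbitrary amplification. -/
theorem lpAmplification_mem_closure {J : Type*} (M : StarSubalgebra ℂ (H →L[ℂ] H))
    {x : H →L[ℂ] H} (hx : x ∈ Set.centralizer (Set.centralizer (M : Set (H →L[ℂ] H))))
    (ξ : lp (fun _ : J => H) 2) :
    lpAmplification J x ξ ∈ closure ((fun y => lpAmplification J y ξ) '' (M : Set (H →L[ℂ] H))) := by
  classical
  let L : (H →L[ℂ] H) →ₗ[ℂ] lp (fun _ : J => H) 2 :=
    { toFun := fun y => lpAmplification J y ξ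
      map_add' := fun y z => by ext j; simp
      map_smul' := fun c y => by ext j; simp }
  -- The projection onto the closed orbit `T` of `ξ` commutes with the amplified `M`: `T` is
  -- invariant, and so is `Tᗮ` because `M` is closed under `star`.
  let S : Submodule ℂ (lp (fun _ : J => H) 2) := (M.toSubalgebra.toSubmodule).map L
  let T := S.topologicalClosure
  have : CompleteSpace T := S.isClosed_topologicalClosure.completeSpace_coe
  have hT : ∀ m ∈ M, ∀ ζ ∈ T, lpAmplification J m ζ ∈ T := by
    intro m hm ζ hζ
    refine map_mem_closure (lpAmplification J m).continuous hζ ?_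
    rintro _ ⟨y, hy, rfl⟩
    exact ⟨m * y, M.mul_mem hm hy, by ext j; rfl⟩
  have hTo : ∀ m ∈ M, ∀ ζ ∈ Tᗮ, lpAmplification J m ζ ∈ Tᗮ := by
    intro m hm ζ hζ
    rw [Submodule.mem_orthogonal] at hζ ⊢
    intro u hu
    rw [inner_lpAmplification_star]
    exact hζ _ (hT _ (star_mem hm) u hu)
  have hcomm : ∀ m ∈ M, ∀ ζ, T.starProjection (lpAmplification J m ζ) =
      lpAmplification J m (T.starProjection ζ) := by
    intro m hm ζ
    refine Submodule.eq_starProjection_of_mem_orthogonal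
      (hT m hm _ (Submodule.starProjection_apply_mem _ _)) ?_
    rw [← map_sub]
    exact hTo m hm _ (Submodule.sub_starProjection_mem_orthogonal _)
  have hsingle (y : H →L[ℂ] H) (j : J) (h : H) : lpAmplification J y (lp.single 2 j h) =
      lp.single 2 j (y h) := by
    ext i
    by_cases hij : i = j
    · subst hij; simp
    · simp [hij]
  -- The matrix entries of the projection lie in the commutant of `M`, so `x` commutes with each of
  -- them, and its amplification with the projection.
  let E (i j : J) : H →L[ℂ] H := (lp.evalCLM ℂ (fun _ : J => H) 2 i) ∘L T.starProjection ∘L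
    lp.singleContinuousLinearMap ℂ (fun _ : J => H) 2 j
  have hE (i j : J) (h : H) : E i j h = T.starProjection (lp.single 2 j h) i := rfl
  have hEx (i j : J) : E i j * x = x * E i j := by
    refine hx (E i j) fun m hm => ?_
    ext h
    change m (E i j h) = E i j (m h)
    rw [hE, hE, ← hsingle, hcomm m hm, lpAmplification_apply]
  have hxp : T.starProjection ∘L lpAmplification J x = lpAmplification J x ∘L T.starProjection := by
    refine lp.ext_continuousLinearMap (by simp) fun j => ?_
    ext h i
    have := congrArg (fun A : H →L[ℂ] H => A h) (hEx i j)
    change E i j (x h) = x (E i j h) at this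
    rw [hE, hE] at this
    simpa [hsingle] using this
  have hξ : ξ ∈ T := S.le_topologicalClosure ⟨1, one_mem M, by ext j; rfl⟩
  have h := congrArg (fun A => A ξ) hxp
  simp only [ContinuousLinearMap.comp_apply] at h
  rw [Submodule.starProjection_eq_self_iff.mpr hξ, Submodule.starProjection_eq_self_iff] at h
  exact h

omit [CompleteSpace H] in
theorem IsTraceClass.exists_summable_sq {T : H →L[ℂ] H} (hT : IsTraceClass T) :
    ∃ u v : ℕ → H, Summable (fun n => ‖u n‖ ^ 2) ∧ Summable (fun n => ‖v n‖ ^ 2) ∧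
      ∀ w : H, HasSum (fun n => ⟪u n, w⟫_ℂ • v n) (T w) := by
  obtain ⟨u, v, hs, h⟩ := hT
  -- Balances the factors: both rescaled squared norms become `‖u n‖ * ‖v n‖`. If `u n` or `v n` is
  -- zero, then `c n = 0`, and the term vanishes anyway.
  let c (n : ℕ) : ℝ := √(‖v n‖ / ‖u n‖)
  have hc (n : ℕ) : c n ^ 2 = ‖v n‖ / ‖u n‖ := Real.sq_sqrt (by positivity)
  refine ⟨fun n => (c n : ℂ) • u n, fun n => ((c n)⁻¹ : ℂ) • v n, ?_, ?_, fun w => ?_⟩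
  · refine hs.of_nonneg_of_le (fun _ => by positivity) fun n => ?_
    rw [norm_smul, mul_pow, Complex.norm_real, Real.norm_eq_abs, sq_abs, hc]
    by_cases hu : ‖u n‖ = 0
    · simp [hu]
    · exact le_of_eq (by field_simp)
  · refine hs.of_nonneg_of_le (fun _ => by positivity) fun n => ?_
    rw [norm_smul, mul_pow, norm_inv, Complex.norm_real, Real.norm_eq_abs, inv_pow, sq_abs, hc]
    by_cases hv : ‖v n‖ = 0
    · simp [hv]
    · exact le_of_eq (by field_simp)
  · convert h w using 2 with n
    by_cases hu : u n = 0
    · simp [hu]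
    by_cases hv : v n = 0
    · simp [hv]
    have hc0 : (c n : ℂ) ≠ 0 := by
      have : 0 < c n := Real.sqrt_pos.mpr (by positivity)
      exact_mod_cast this.ne'
    rw [inner_smul_left, smul_smul, Complex.conj_ofReal]
    congr 1
    field_simp

theorem weakStarTopology_eq_induced : weakStarTopology H =
    TopologicalSpace.induced
      (fun (x : H →L[ℂ] H) (T : {T : H →L[ℂ] H // IsTraceClass T}) => opTrace (x * T.1))
      inferInstance := by
  simp only [weakStarTopology, Pi.topologicalSpace, induced_iInf, induced_compose]
  rfl

/-- The double commutant of a unital star subalgebra of `B(H)` lies in its w*-closure. -/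
theorem mem_weakStar_closure_of_mem_centralizer_centralizer (M : StarSubalgebra ℂ (H →L[ℂ] H))
    {x : H →L[ℂ] H} (hx : x ∈ Set.centralizer (Set.centralizer (M : Set (H →L[ℂ] H)))) :
    x ∈ @closure _ (weakStarTopology H) (M : Set (H →L[ℂ] H)) := by
  classical
  rw [weakStarTopology_eq_induced, closure_induced, mem_closure_iff]
  intro O hO hxO
  obtain ⟨I, U, hU, hsub⟩ := isOpen_pi_iff.mp hO _ hxO
  choose u v hu hv huv using
    fun T : {T : H →L[ℂ] H // IsTraceClass T} => T.2.exists_summable_sq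
  -- A basic neighbourhood tests finitely many `T`. Stacking their vectors into one `ξ`, with `η T`
  -- selecting block `T`, turns every trace functional into an inner product against the same orbit.
  let ξ : lp (fun _ : I × ℕ => H) 2 := ⟨fun p => v p.1 p.2, memℓp_gen <| by
    refine (summable_prod_of_nonneg fun _ => by positivity).mpr
      ⟨fun T => by simpa using hv T.1, Summable.of_finite⟩⟩
  let η (T : I) : lp (fun _ : I × ℕ => H) 2 :=
    ⟨fun p => if p.1 = T then u T p.2 else 0, memℓp_gen <| by
      refine (summable_prod_of_nonneg fun _ => by positivity).mpr
        ⟨fun S => ?_, Summable.of_finite⟩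
      by_cases h : S = T
      · simpa [h] using hu T.1
      · simp [h, summable_zero]⟩
  have htr (y : H →L[ℂ] H) (T : I) :
      opTrace (y * T.1.1) = ⟪η T, lpAmplification (I × ℕ) y ξ⟫_ℂ := by
    have hs : Summable fun n => ‖u T n‖ * ‖v T n‖ :=
      ((hu T).add (hv T)).of_nonneg_of_le (fun _ => by positivity) fun n => by
        nlinarith [sq_nonneg (‖u T n‖ - ‖v T n‖), sq_nonneg ‖u T n‖, sq_nonneg ‖v T n‖]
    rw [opTrace_mul_eq_tsum hs (huv T), lp.inner_eq_tsum]
    have hinj : Function.Injective fun n : ℕ => (T, n) := fun a b h => (Prod.ext_iff.mp h).2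
    rw [← hinj.tsum_eq]
    · simp [η, ξ]
    · rintro ⟨S, n⟩ hS
      by_cases h : S = T
      · exact ⟨n, by rw [h]⟩
      · simp [η, h] at hS
  have hopen : IsOpen (⋂ T : I, (fun ζ => ⟪η T, ζ⟫_ℂ) ⁻¹' U T) :=
    isOpen_iInter_of_finite fun T => (hU T T.2).1.preimage (by fun_prop)
  obtain ⟨_, hζ, y, hy, rfl⟩ := mem_closure_iff.mp (lpAmplification_mem_closure M hx ξ) _ hopen
    (Set.mem_iInter.mpr fun T => by
      rw [Set.mem_preimage, ← htr]; exact (hU T T.2).2)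
  refine ⟨_, hsub fun T hT => ?_, y, hy, rfl⟩
  have := Set.mem_iInter.mp hζ ⟨T, hT⟩
  rwa [Set.mem_preimage, ← htr] at this

/-- Von Neumann's double commutant theorem: a w*-closed unital star subalgebra of `B(H)` is a
von Neumann algebra. -/
noncomputable def VonNeumannAlgebra.ofWeakStarClosed (M : StarSubalgebra ℂ (H →L[ℂ] H))
    (hM : IsClosed[weakStarTopology H] (M : Set (H →L[ℂ] H))) : VonNeumannAlgebra H where
  toStarSubalgebra := M
  centralizer_centralizer' := Set.Subset.antisymm
    (fun _ hx => (@IsClosed.closure_eq _ (weakStarTopology H) _ hM).subset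
      (mem_weakStar_closure_of_mem_centralizer_centralizer M hx))
    Set.subset_centralizer_centralizer

/-- Rank-one operators already separate points, since they recover all matrix coefficients. -/
theorem t2Space_weakStarTopology : @T2Space _ (weakStarTopology H) := by
  rw [weakStarTopology_eq_induced]
  refine @T2Space.of_injective_continuous _ _ (_) _ _ (f := fun (x : H →L[ℂ] H)
    (T : {T : H →L[ℂ] H // IsTraceClass T}) => opTrace (x * T.1)) ?_ continuous_induced_dom
  intro x y hxy
  ext w
  refine ext_inner_left ℂ fun z => ?_
  simpa [opTrace_mul_rankOne] using
    congrFun hxy ⟨InnerProductSpace.rankOne ℂ w z, isTraceClass_rankOne z w⟩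

end DoubleCommutant

/-! ### Integrals over the half-line -/

section HalfLine

/-- Continuous telescoping: over `[0, n]` the integral equals that of `g` over `[n, n + s]` minus
that over `[0, s]`. -/
theorem lintegral_shift_sub_le {g : ℝ → ℝ} (hc : Continuous g) (hm : Monotone g) {K : ℝ}
    (h0 : ∀ r, 0 ≤ g r) (hK : ∀ r, g r ≤ K) {s : ℝ} (hs : 0 ≤ s) :
    ∫⁻ r in Set.Ici 0, ENNReal.ofReal (g (r + s) - g r) ≤ ENNReal.ofReal (s * K) := by
  have hU : Set.Ici (0 : ℝ) = ⋃ n : ℕ, Set.Icc 0 (n : ℝ) := by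
    ext r
    simp only [Set.mem_Ici, Set.mem_iUnion, Set.mem_Icc]
    exact ⟨fun h => (exists_nat_ge r).imp fun n hn => ⟨h, hn⟩, fun ⟨n, h⟩ => h.1⟩
  have hint : ∀ a b : ℝ, IntervalIntegrable g volume a b := fun a b => hc.intervalIntegrable a b
  have hd : ∀ r, 0 ≤ g (r + s) - g r := fun r => sub_nonneg.mpr (hm (by linarith))
  rw [hU, setLIntegral_iUnion_of_directed]
  · refine iSup_le fun n => ?_
    have hn : (0 : ℝ) ≤ n := n.cast_nonneg
    rw [setLIntegral_congr Ioc_ae_eq_Icc.symm, ← ofReal_integral_eq_lintegral_ofReal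
      ((by fun_prop : Continuous fun r => g (r + s) - g r).integrableOn_Ioc)
      (Filter.Eventually.of_forall hd), ← intervalIntegral.integral_of_le hn]
    refine ENNReal.ofReal_le_ofReal ?_
    rw [intervalIntegral.integral_sub
      ((by fun_prop : Continuous fun r => g (r + s)).intervalIntegrable _ _) (hint _ _),
      intervalIntegral.integral_comp_add_right,
      intervalIntegral.integral_interval_sub_interval_comm (hint _ _) (hint _ _) (hint _ _)]
    have h1 : 0 ≤ ∫ r in (0 : ℝ)..(0 + s), g r :=
      intervalIntegral.integral_nonneg (by linarith) fun r _ => h0 r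
    have h2 : ∫ r in (n : ℝ)..(n + s), g r ≤ s * K := by
      refine (intervalIntegral.integral_mono_on (by linarith) (hint _ _)
        intervalIntegrable_const fun r _ => hK r).trans ?_
      simp
    have h3 := intervalIntegral.integral_symm (f := g) (μ := volume) (n : ℝ) (n + s)
    have h4 := intervalIntegral.integral_symm (f := g) (μ := volume) 0 s
    simp only [zero_add] at h1 ⊢
    linarith
  · exact Monotone.directed_le fun a b hab => by
      gcongr

theorem apply_eq_zero_of_lintegral_Ici_eq_zero {h : ℝ → ℝ≥0∞} (hc : Continuous h)
    (hz : ∫⁻ r in Set.Ici 0, h r = 0) : h 0 = 0 := by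
  rw [lintegral_eq_zero_iff hc.measurable] at hz
  exact Measure.eqOn_of_ae_eq hz hc.continuousOn continuousOn_const (by simp)
    (Set.mem_Ici.mpr le_rfl)

end HalfLine

/-! ### Recurrence makes positive subharmonic operators harmonic -/

namespace QuantumChannelSemigroup

variable {H : Type*} [NormedAddCommGroup H] [InnerProductSpace ℂ H] [CompleteSpace H]

section General

variable {𝔗 : Type*} [AddMonoid 𝔗] [TopologicalSpace 𝔗]

theorem re_inner_mono {x y : H →L[ℂ] H} (h : x ≤ y) (v : H) :
    (⟪v, x v⟫_ℂ).re ≤ (⟪v, y v⟫_ℂ).re := by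
  have := ((ContinuousLinearMap.nonneg_iff_isPositive _).mp (sub_nonneg.mpr h)).re_inner_nonneg_right v
  simpa [inner_sub_right] using this

theorem eq_zero_of_re_inner_eq_zero {x : H →L[ℂ] H} (hx : 0 ≤ x) {v : H}
    (hv : (⟪v, x v⟫_ℂ).re = 0) : x v = 0 := by
  obtain ⟨s, rfl⟩ := CStarAlgebra.nonneg_iff_eq_star_mul_self.mp hx
  have h : s v = 0 := by
    rw [mul_apply_eq_comp, ContinuousLinearMap.star_eq_adjoint,
      ContinuousLinearMap.adjoint_inner_right, inner_self_eq_norm_sq_to_K] at hv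
    rw [← norm_eq_zero, ← sq_eq_zero_iff]
    exact_mod_cast hv
  simp [h]

variable (P : QuantumChannelSemigroup 𝔗 H)

theorem channel_mono (t : 𝔗) {x y : H →L[ℂ] H} (h : x ≤ y) :
    (P.channel t).toMap x ≤ (P.channel t).toMap y :=
  OrderHomClass.mono _ h

theorem channel_nonneg (t : 𝔗) {x : H →L[ℂ] H} (h : 0 ≤ x) : 0 ≤ (P.channel t).toMap x := by
  simpa using P.channel_mono t h

theorem re_inner_channel_le (t : 𝔗) {y : H →L[ℂ] H} (hy : 0 ≤ y) (v : H) :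
    (⟪v, (P.channel t).toMap y v⟫_ℂ).re ≤ ‖y‖ * ‖v‖ ^ 2 := by
  have h1 : y ≤ (‖y‖ : ℂ) • (1 : H →L[ℂ] H) := by
    have := IsSelfAdjoint.le_algebraMap_norm_self (a := y) (IsSelfAdjoint.of_nonneg hy)
    rwa [Algebra.algebraMap_eq_smul_one, ← Complex.coe_smul] at this
  have h2 := P.channel_mono t h1
  rw [map_smul, (P.channel t).map_one'] at h2
  refine (re_inner_mono h2 v).trans ?_
  simp only [smul_apply, one_apply_eq_self, inner_smul_right,
    inner_self_eq_norm_sq_to_K]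
  exact le_of_eq (by norm_cast; exact (Complex.re_ofReal_mul _ _).trans rfl)

variable [MeasurableSpace 𝔗] {P} {m : Measure 𝔗}

variable (P m) in
theorem formPotential_eq_lintegral (x : H →L[ℂ] H) (v : H) :
    P.formPotential m x v =
      ∫⁻ t, ENNReal.ofReal (⟪v, (P.channel t).toMap x v⟫_ℂ).re ∂m := by
  simp only [formPotential, opTrace_rankOne_mul]

/-- A recurrent semigroup has no nonzero positive operator of bounded form-potential, as soon as
the kernel of the potential is contained in the kernel of the operator. -/
theorem IsRecurrent.eq_zero (hP : P.IsRecurrent m) {x : H →L[ℂ] H} (hx : 0 ≤ x)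
    (hb : P.IsBoundedPotential m x)
    (hz : ∀ v, P.formPotential m x v = 0 → (⟪v, x v⟫_ℂ).re = 0) : x = 0 := by
  have hT : P.transientSpace m = ⊥ := (Submodule.orthogonal_eq_top_iff _).mp hP
  have hS : P.potentialSupport m x = ⊥ := by
    rw [eq_bot_iff, ← hT]
    exact (le_iSup (fun x : {x : H →L[ℂ] H // 0 ≤ x ∧ P.IsBoundedPotential m x} =>
      P.potentialSupport m x.1) ⟨x, hx, hb⟩).trans (Submodule.le_topologicalClosure _)
  -- Thus `x.kerᗮ` lies in the trivial support, and the closed subspace `x.ker` is everything.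
  have hker : Submodule.span ℂ {v : H | P.formPotential m x v = 0} ≤ x.ker :=
    Submodule.span_le.mpr fun v hv => eq_zero_of_re_inner_eq_zero hx (hz v hv)
  have hbot : (x.ker)ᗮ = ⊥ := eq_bot_iff.mpr ((Submodule.orthogonal_le hker).trans hS.le)
  have : CompleteSpace x.ker := x.isClosed_ker.completeSpace_coe
  rw [Submodule.orthogonal_eq_bot_iff] at hbot
  ext v
  have : v ∈ x.ker := hbot ▸ Submodule.mem_top
  simpa using this

theorem isBoundedPotential_of_le {x : H →L[ℂ] H} {K : ℝ}
    (h : ∀ v, P.formPotential m x v ≤ ENNReal.ofReal (K * ‖v‖ ^ 2)) :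
    P.IsBoundedPotential m x := by
  refine ⟨K.toNNReal, fun v => (h v).trans ?_⟩
  rw [ENNReal.ofReal_mul' (by positivity), ENNReal.ofReal_pow (norm_nonneg v), ofReal_norm]
  rfl

end General

/-- The potential of the one-step increment telescopes, with partial sums at most `⟪v, P_N y v⟫ ≤
‖y‖ ‖v‖²`; its `n = 0` term is `⟪v, w v⟫`. -/
theorem IsRecurrent.channel_eq_of_subharmonic_nat {P : QuantumChannelSemigroup ℕ H}
    (hP : P.IsRecurrent Measure.count) {y : H →L[ℂ] H} (hy : 0 ≤ y)
    (hsub : ∀ t, y ≤ (P.channel t).toMap y) (t : ℕ) : (P.channel t).toMap y = y := by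
  set w := (P.channel 1).toMap y - y with hw
  have hw0 : 0 ≤ w := sub_nonneg.mpr (hsub 1)
  have hpot (v : H) : P.formPotential Measure.count w v =
      ∑' n, ENNReal.ofReal (⟪v, (P.channel n).toMap w v⟫_ℂ).re := by
    rw [formPotential_eq_lintegral, lintegral_count]
  have hstep (n : ℕ) : (P.channel n).toMap w =
      (P.channel (n + 1)).toMap y - (P.channel n).toMap y := by
    rw [hw, map_sub, P.channel_add]
  have h0 : w = 0 := by
    refine hP.eq_zero hw0 (isBoundedPotential_of_le (K := ‖y‖) fun v => ?_) fun v hv => ?_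
    · rw [hpot]
      refine ENNReal.tsum_le_of_sum_range_le fun N => ?_
      rw [← ENNReal.ofReal_sum_of_nonneg fun n _ => by
        simpa using re_inner_mono (P.channel_nonneg n hw0) v]
      refine ENNReal.ofReal_le_ofReal ?_
      simp only [hstep, sub_apply, inner_sub_right, Complex.sub_re]
      rw [Finset.sum_range_sub fun n => (⟪v, (P.channel n).toMap y v⟫_ℂ).re]
      have h1 := P.re_inner_channel_le N hy v
      have h2 := re_inner_mono (P.channel_nonneg 0 hy) v
      simp only [zero_apply, inner_zero_right, Complex.zero_re] at h2
      linarith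
    · rw [hpot, ENNReal.tsum_eq_zero] at hv
      have h1 := hv 0
      rw [P.channel_zero, ENNReal.ofReal_eq_zero] at h1
      exact le_antisymm h1 (by simpa using re_inner_mono hw0 v)
  induction t with
  | zero => exact P.channel_zero y
  | succ n ih => rw [P.channel_add, sub_eq_zero.mp (hw.symm.trans h0), ih]

/-- Here the increment is taken over the given time `s`. Subharmonicity makes `t ↦ ⟪v, P_t y v⟫`
increasing, so telescoping bounds the potential with constant `s * ‖y‖`. -/
theorem IsRecurrent.channel_eq_of_subharmonic_nnreal {P : QuantumChannelSemigroup ℝ≥0 H}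
    (hP : P.IsRecurrent halfLineLebesgue) {y : H →L[ℂ] H} (hy : 0 ≤ y)
    (hsub : ∀ t, y ≤ (P.channel t).toMap y) (s : ℝ≥0) : (P.channel s).toMap y = y := by
  set w := (P.channel s).toMap y - y with hw
  have hw0 : 0 ≤ w := sub_nonneg.mpr (hsub s)
  have hcont (x : H →L[ℂ] H) (v : H) : Continuous fun t => (⟪v, (P.channel t).toMap x v⟫_ℂ).re := by
    have h := continuous_iInf_rng.mp (P.weakStar_continuous x)
      ⟨InnerProductSpace.rankOne ℂ v v, isTraceClass_rankOne v v⟩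
    simpa [Function.comp_def, opTrace_mul_rankOne] using
      Complex.continuous_re.comp (continuous_induced_rng.mp h)
  have hpot (v : H) : P.formPotential halfLineLebesgue w v =
      ∫⁻ r in Set.Ici (0 : ℝ),
        ENNReal.ofReal (⟪v, (P.channel r.toNNReal).toMap w v⟫_ℂ).re := by
    rw [formPotential_eq_lintegral, halfLineLebesgue, lintegral_map _ measurable_real_toNNReal]
    exact (ENNReal.continuous_ofReal.comp (hcont w v)).measurable
  refine sub_eq_zero.mp (hP.eq_zero hw0
    (isBoundedPotential_of_le (K := s * ‖y‖) fun v => ?_) fun v hv => ?_)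
  · rw [hpot]
    have hmono : Monotone fun t => (⟪v, (P.channel t).toMap y v⟫_ℂ).re := fun a b hab => by
      obtain ⟨c, rfl⟩ := exists_add_of_le hab
      simp only [P.channel_add]
      exact re_inner_mono (P.channel_mono a (hsub c)) v
    refine le_trans (le_of_eq ?_) ((lintegral_shift_sub_le
      (g := fun r => (⟪v, (P.channel r.toNNReal).toMap y v⟫_ℂ).re)
      ((hcont y v).comp continuous_real_toNNReal) (hmono.comp fun _ _ h => Real.toNNReal_mono h)
      (fun r => by simpa using re_inner_mono (P.channel_nonneg r.toNNReal hy) v)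
      (fun r => P.re_inner_channel_le r.toNNReal hy v) s.2).trans (le_of_eq ?_))
    · refine setLIntegral_congr_fun measurableSet_Ici fun r hr => ?_
      have : (r + s).toNNReal = r.toNNReal + s := by
        rw [Real.toNNReal_add (Set.mem_Ici.mp hr) s.coe_nonneg, Real.toNNReal_coe]
      simp only [NNReal.val_eq_coe, this, hw, map_sub, P.channel_add,
        sub_apply, inner_sub_right, Complex.sub_re]
    · rw [mul_assoc]; rfl
  · rw [hpot] at hv
    -- Continuity upgrades vanishing almost everywhere to vanishing at time `0`, where the channel
    -- is the identity.
    have h1 := apply_eq_zero_of_lintegral_Ici_eq_zero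
      (ENNReal.continuous_ofReal.comp ((hcont w v).comp continuous_real_toNNReal)) hv
    simp only [Function.comp_apply, Real.toNNReal_zero, P.channel_zero,
      ENNReal.ofReal_eq_zero] at h1
    exact le_antisymm h1 (by simpa [-sub_apply, hw] using re_inner_mono hw0 v)

end QuantumChannelSemigroup

/-! ### The algebra of fixed points -/

namespace QuantumChannelSemigroup

variable {𝔗 : Type*} [AddMonoid 𝔗] [TopologicalSpace 𝔗]
  {H : Type*} [NormedAddCommGroup H] [InnerProductSpace ℂ H] [CompleteSpace H]
  (P : QuantumChannelSemigroup 𝔗 H)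

/-- An intersection of equalizers of continuous maps in a Hausdorff topology. -/
theorem isClosed_fixedPoints : IsClosed[weakStarTopology H] P.fixedPoints := by
  have h : P.fixedPoints = ⋂ t, {x | (P.channel t).toMap x = x} := by
    ext x; simp [fixedPoints]
  rw [h]
  exact @isClosed_iInter _ _ (weakStarTopology H) _ fun t =>
    @isClosed_eq _ _ (weakStarTopology H) (weakStarTopology H) t2Space_weakStarTopology _ _
      (P.channel t).weakStar_continuous' (@continuous_id _ (weakStarTopology H))

variable {P} (hP : ∀ y : H →L[ℂ] H, 0 ≤ y → (∀ t, y ≤ (P.channel t).toMap y) → y ∈ P.fixedPoints)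
include hP

theorem star_mul_self_mem_fixedPoints {x : H →L[ℂ] H} (hx : x ∈ P.fixedPoints) :
    star x * x ∈ P.fixedPoints :=
  hP _ (star_mul_self_nonneg x) fun t => by
    simpa only [hx t] using (P.channel t).toMap.star_mul_self_le (P.channel t).map_one' x

theorem mul_mem_fixedPoints {x y : H →L[ℂ] H} (hx : x ∈ P.fixedPoints) (hy : y ∈ P.fixedPoints) :
    x * y ∈ P.fixedPoints := by
  intro t
  -- Polarization, used with `a = star x`, writes `x * y` through squares of the fixed points `star
  -- x + c • y`, `c ∈ {±1, ±I}`.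
  have hpol (a b : H →L[ℂ] H) : star a * b = (4 : ℂ)⁻¹ • (star (a + b) * (a + b)
      - star (a - b) * (a - b) - Complex.I • (star (a + Complex.I • b) * (a + Complex.I • b))
      + Complex.I • (star (a - Complex.I • b) * (a - Complex.I • b))) := by
    rw [eq_inv_smul_iff₀ (by norm_num)]
    simp only [star_add, star_sub, star_smul, add_mul, sub_mul, mul_add, mul_sub, smul_mul_assoc,
      mul_smul_comm, smul_add, smul_sub, smul_smul, RCLike.star_def, Complex.conj_I, mul_neg,
      Complex.I_mul_I]
    module
  have hstar (c : ℂ) : star (star x + c • y) * (star x + c • y) ∈ P.fixedPoints :=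
    star_mul_self_mem_fixedPoints hP fun t => by
      rw [map_add, map_smul, map_star, hx t, hy t]
  have h := hpol (star x) y
  rw [star_star] at h
  have h1 := hstar 1 t
  have h2 := hstar (-1) t
  have h3 := hstar Complex.I t
  have h4 := hstar (-Complex.I) t
  simp only [one_smul, neg_smul, ← sub_eq_add_neg] at h1 h2 h3 h4
  rw [h, map_smul, map_add, map_sub, map_sub, map_smul, map_smul, h1, h2, h3, h4]

theorem exists_vonNeumannAlgebra_eq_fixedPoints :
    ∃ M : VonNeumannAlgebra H, (M : Set (H →L[ℂ] H)) = P.fixedPoints := by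
  let M : StarSubalgebra ℂ (H →L[ℂ] H) :=
    { carrier := P.fixedPoints
      mul_mem' := mul_mem_fixedPoints hP
      add_mem' := fun hx hy t => by rw [map_add, hx t, hy t]
      algebraMap_mem' := fun c t => by
        rw [Algebra.algebraMap_eq_smul_one, map_smul, (P.channel t).map_one']
      star_mem' := fun hx t => by rw [map_star, hx t] }
  exact ⟨VonNeumannAlgebra.ofWeakStarClosed M P.isClosed_fixedPoints, rfl⟩

end QuantumChannelSemigroup

theorem mainTheorem1 {H : Type*} [NormedAddCommGroup H] [InnerProductSpace ℂ H]
    [CompleteSpace H] [TopologicalSpace.SeparableSpace H] :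
    (∀ P : QuantumChannelSemigroup ℕ H, P.IsRecurrent Measure.count →
      ∃ M : VonNeumannAlgebra H, (M : Set (H →L[ℂ] H)) = P.fixedPoints) ∧
    (∀ P : QuantumChannelSemigroup ℝ≥0 H, P.IsRecurrent halfLineLebesgue →
      ∃ M : VonNeumannAlgebra H, (M : Set (H →L[ℂ] H)) = P.fixedPoints) :=
  ⟨fun _ hP => QuantumChannelSemigroup.exists_vonNeumannAlgebra_eq_fixedPoints
      fun _ hy h t => hP.channel_eq_of_subharmonic_nat hy h t,
    fun _ hP => QuantumChannelSemigroup.exists_vonNeumannAlgebra_eq_fixedPoints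
      fun _ hy h t => hP.channel_eq_of_subharmonic_nnreal hy h t⟩
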